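/- Let $\mathbb{k}$ be an algebraically closed field of characteristic zero and let $\mathbb{k}^*=\mathbb{k}\setminus\{0\}$ be its multiplicative group. Let $n\ge 0$, let $m_1,\dots,m_n$ be positive integers with $m_i\mid m_{i+1}$ for $1\le i\le n-1$, and let $G=\mathbb{Z}_{m_1}\times\cdots\times\mathbb{Z}_{m_n}$, acting trivially on $\mathbb{k}^*$. Then for every integer $k\ge 1$ the integers $$N_{k,r}=\sum_{j=1}^{k}(-1)^{k+j}\binom{n-r+j-1}{j-1}\qquad(1\le r\le n)$$ are non-negative, and there is an isomorphism of abelian groups $$\operatorname{H}^k(G,\mathbb{k}^*)\;\cong\;\prod_{r=1}^{n}\mathbb{Z}_{m_r}^{\,N_{k,r}}.$$ -/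

import Mathlib

universe u

/-- The cohomology group `H^k(G, Kˣ)` of a group `G` with coefficients in the multiplicative group
of a field `K`, regarded as a trivial `ℤ[G]`-module, as an additive group. Mathlib's
`groupCohomology` asks that the base ring, the group and the module live in one universe;
`ULift` moves `ℤ` and `G` to the universe of `K`, and changes nothing else. -/
noncomputable abbrev unitsCohomology (G : Type) [Group G] (K : Type u) [Field K] (k : ℕ) :
    ModuleCat.{u} (ULift.{u} ℤ) :=
  groupCohomology (Rep.trivial (ULift.{u} ℤ) (ULift.{u} G) (Additive Kˣ)) k

/-! Induct on the number of cyclic factors, splitting off the one of smallest order `m`. Let `χ : G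
→ ZMod m` be its projection, `H = ker χ`, `p : G → H` the retraction, and `A` the coefficients. Then
`H^k(G, A)` is the direct sum of `p^* H^k(H, A)` and the kernel `C^k` of restriction to `H`, so only
`C^k` has to be computed.

Let `F` be the functions `ZMod m → A` and `F₀` those of sum zero. There are exact sequences `0 → A →
F → F₀ → 0` and `0 → F₀ → F → A → 0`, and Shapiro's lemma gives `H^k(G, F) = H^k(H, A)`. The
inclusion of constants becomes restriction to `H`, which `p` splits, so `C^(k+1) ≅ H^k(G, F₀)`. The
sum of values becomes `m p^*`, so `H^(k+1)(G, F₀)` is an extension of `H^(k+1)(H, A)[m]` by `C^k ⊕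
H^k(H, A)/m`. Everything here is killed by `m`, and both ends are free over `ZMod m` because `m`
divides the remaining orders; hence the extension splits (`nonempty_addEquiv_of_exact`).

Thus the rank `c` of `C` satisfies `c (k + 2) = c k + a k + b (k + 1)`, with `a`, `b` the ranks of
the quotient and the torsion for `H`. The alternating binomial sums satisfy the same recursion
(`alternatingRank_add_two`). About `Kˣ` one needs only that it is divisible with cyclic `m`-torsion
of order `m`. -/

open CategoryTheory

/-! ### Functions on a cyclic quotient and their two short exact sequences -/

section CyclicFunctions

variable {R G : Type u} [CommRing R] [Group G] {m : ℕ} (χ : G →* Multiplicative (ZMod m))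
  (A : Type u) [AddCommGroup A] [Module R A]

/-- The representation of `G` on functions `ZMod m → A`, acting by translation through a
character `χ : G → ZMod m`. -/
def shiftRepresentation : Representation R G (ZMod m → A) where
  toFun g := LinearMap.funLeft R A (· + (χ g).toAdd)
  map_one' := by ext; simp [LinearMap.funLeft_apply]
  map_mul' g h := by
    ext f x
    simp [LinearMap.funLeft_apply, add_comm, add_left_comm]

@[simp]
lemma shiftRepresentation_apply (g : G) (f : ZMod m → A) (x : ZMod m) :
    shiftRepresentation (R := R) χ A g f x = f (x + (χ g).toAdd) := rfl

variable (R) in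
/-- The functions `ZMod m → A` with `G` acting by translation through `χ`. -/
noncomputable abbrev shiftRep : Rep R G := Rep.of (shiftRepresentation (R := R) χ A)

variable (R) in
/-- The inclusion of the constant functions. -/
noncomputable def constHom : Rep.trivial R G A ⟶ shiftRep R χ A :=
  Rep.ofHom ⟨LinearMap.pi fun _ => LinearMap.id, fun g => by ext; simp⟩

variable [NeZero m]

variable (R) in
/-- The sum of the values of a function. -/
noncomputable def totalHom : shiftRep R χ A ⟶ Rep.trivial R G A :=
  Rep.ofHom ⟨∑ x : ZMod m, LinearMap.proj x, fun g => by
    refine LinearMap.ext fun f => ?_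
    simp only [LinearMap.comp_apply, LinearMap.sum_apply, LinearMap.proj_apply,
      shiftRepresentation_apply, Representation.trivial_apply]
    exact Equiv.sum_comp (Equiv.addRight (χ g).toAdd) f⟩

@[simp]
lemma totalHom_apply (f : ZMod m → A) : (totalHom R χ A).hom f = ∑ x, f x := by
  change (∑ x : ZMod m, LinearMap.proj (R := R) x : (ZMod m → A) →ₗ[R] A) f = _
  simp

/-- The subrepresentation of functions with vanishing sum of values. -/
noncomputable def zeroSumRepresentation :
    Representation R G (LinearMap.ker (totalHom R χ A).hom.toLinearMap) where
  toFun g := (shiftRepresentation χ A g).restrict fun f hf => by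
    have := Rep.hom_comm_apply (totalHom R χ A) g f
    rw [LinearMap.mem_ker] at hf ⊢
    exact this.trans (by simpa using hf)
  map_one' := by ext; simp
  map_mul' g h := by ext f x; simp

variable (R) in
/-- The functions with vanishing sum of values, as a representation. -/
noncomputable abbrev zeroSumRep : Rep R G := Rep.of (zeroSumRepresentation (R := R) χ A)

variable (R) in
/-- The inclusion of the functions with vanishing sum of values. -/
noncomputable def zeroSumHom : zeroSumRep R χ A ⟶ shiftRep R χ A :=
  Rep.ofHom ⟨Submodule.subtype _, fun g => by ext; rfl⟩

variable (R) in
/-- The difference operator `f ↦ (x ↦ f (x + 1) - f x)`. -/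
noncomputable def diffHom : shiftRep R χ A ⟶ zeroSumRep R χ A :=
  Rep.ofHom ⟨LinearMap.codRestrict _ (LinearMap.funLeft R A (· + 1) - LinearMap.id) fun f => by
      rw [LinearMap.mem_ker]
      refine (totalHom_apply χ A _).trans ?_
      simp only [LinearMap.sub_apply, Pi.sub_apply, LinearMap.id_apply, Finset.sum_sub_distrib,
        LinearMap.funLeft_apply]
      rw [sub_eq_zero]
      exact Equiv.sum_comp (Equiv.addRight (1 : ZMod m)) f, fun g => by
    refine LinearMap.ext fun f => Subtype.ext (funext fun x => ?_)
    change f (x + 1 + (χ g).toAdd) - f (x + (χ g).toAdd)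
      = f (x + (χ g).toAdd + 1) - f (x + (χ g).toAdd)
    rw [add_right_comm]⟩

omit [NeZero m] [AddCommGroup A] in
lemma ZMod.eq_of_add_one_eq {f : ZMod m → A} (h : ∀ x, f (x + 1) = f x) (x : ZMod m) :
    f x = f 0 := by
  obtain ⟨k, rfl⟩ := ZMod.intCast_surjective x
  induction k with
  | zero => simp
  | succ k ih => push_cast at ih ⊢; rw [h, ih]
  | pred k ih => push_cast at ih ⊢; rw [← ih, ← h, sub_add_cancel]

/-- Partial sums over the representatives `0, …, m - 1` give a primitive; the vanishing total makes
it consistent at the wrap-around from `m - 1` to `0`. -/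
lemma ZMod.exists_add_one_sub_eq {f : ZMod m → A} (h : ∑ x, f x = 0) :
    ∃ F : ZMod m → A, ∀ x, F (x + 1) - F x = f x := by
  have hsum : ∑ i ∈ Finset.range m, f (i : ZMod m) = 0 := by
    rw [← h]
    refine Finset.sum_bij (fun i _ => (i : ZMod m)) (fun _ _ => Finset.mem_univ _) ?_ ?_
      (fun _ _ => rfl)
    · intro i hi j hj hij
      rw [Finset.mem_range] at hi hj
      have := congrArg ZMod.val hij
      rwa [ZMod.val_natCast_of_lt hi, ZMod.val_natCast_of_lt hj] at this
    · intro x _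
      exact ⟨x.val, Finset.mem_range.2 x.val_lt, by simp⟩
  refine ⟨fun x => ∑ i ∈ Finset.range x.val, f (i : ZMod m), fun x => ?_⟩
  have hx : x + 1 = ((x.val + 1 : ℕ) : ZMod m) := by simp
  rcases Nat.lt_or_ge (x.val + 1) m with hlt | hge
  · beta_reduce
    rw [hx, ZMod.val_natCast_of_lt hlt, Finset.sum_range_succ]
    simp
  · beta_reduce
    have he : x.val + 1 = m := le_antisymm x.val_lt hge
    rw [hx, he, ZMod.natCast_self, ZMod.val_zero, Finset.sum_range_zero, zero_sub,
      neg_eq_iff_add_eq_zero]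
    have := Finset.sum_range_succ (fun i : ℕ => f i) x.val
    rw [he, hsum] at this
    simpa using this.symm

/-- The short complex `A ⟶ Fun(ZMod m, A) ⟶ Fun₀(ZMod m, A)`. -/
noncomputable abbrev constDiff : ShortComplex (Rep R G) :=
  .mk (constHom R χ A) (diffHom R χ A) <| Rep.hom_ext <|
    Representation.IntertwiningMap.ext <| LinearMap.ext fun (a : A) =>
      Subtype.ext (funext fun _ => sub_self a)

/-- The short complex `Fun₀(ZMod m, A) ⟶ Fun(ZMod m, A) ⟶ A`. -/
noncomputable abbrev zeroSumTotal : ShortComplex (Rep R G) :=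
  .mk (zeroSumHom R χ A) (totalHom R χ A) <| Rep.hom_ext <|
    Representation.IntertwiningMap.ext <| LinearMap.ext
      fun (f : LinearMap.ker (totalHom R χ A).hom.toLinearMap) => f.2

omit [NeZero m] in
lemma Rep.shortExact_of_function_exact {X : ShortComplex (Rep.{u} R G)}
    (hf : Function.Injective X.f.hom) (hg : Function.Surjective X.g.hom)
    (h : ∀ x, X.g.hom x = 0 → ∃ y, X.f.hom y = x) : X.ShortExact where
  exact := (forget₂ (Rep R G) (ModuleCat R)).reflects_exact_of_faithful _ <|
    (ShortComplex.moduleCat_exact_iff _).2 h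
  mono_f := (Rep.mono_iff_injective _).2 hf
  epi_g := (Rep.epi_iff_surjective _).2 hg

lemma constDiff_shortExact : (constDiff (R := R) χ A).ShortExact := by
  refine Rep.shortExact_of_function_exact (fun a b h => congrFun h 0) (fun f => ?_) fun f hf => ?_
  · obtain ⟨F, hF⟩ := ZMod.exists_add_one_sub_eq A (f := f.1)
      ((totalHom_apply (R := R) χ A f.1).symm.trans f.2)
    exact ⟨F, Subtype.ext (funext hF)⟩
  · refine ⟨f 0, funext fun x => (ZMod.eq_of_add_one_eq A (fun y => ?_) x).symm⟩
    exact sub_eq_zero.1 (congrFun (congrArg Subtype.val hf) y)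

lemma zeroSumTotal_shortExact : (zeroSumTotal (R := R) χ A).ShortExact := by
  refine Rep.shortExact_of_function_exact (fun a b h => Subtype.ext h) (fun a => ?_) fun f hf => ?_
  · exact ⟨Pi.single 0 a, (totalHom_apply (R := R) χ A _).trans (by simp)⟩
  · exact ⟨⟨f, hf⟩, rfl⟩

end CyclicFunctions

/-! ### Functoriality in the group for trivial coefficients -/

section TrivialCoefficients

variable {R G H L : Type u} [CommRing R] [Group G] [Group H] [Group L]
  (A : Type u) [AddCommGroup A] [Module R A]

variable (R) in
/-- The map on cohomology with trivial coefficients induced by a group homomorphism. -/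
noncomputable def trivialMap (f : G →* H) (k : ℕ) :
    groupCohomology (Rep.trivial R H A) k ⟶ groupCohomology (Rep.trivial R G A) k :=
  groupCohomology.map f (A := Rep.trivial R H A) (B := Rep.trivial R G A)
    (Rep.ofHom ⟨LinearMap.id, fun g => by ext; rfl⟩) k

lemma trivialMap_id (k : ℕ) : trivialMap R A (MonoidHom.id G) k = 𝟙 _ :=
  groupCohomology.map_id k

lemma trivialMap_comp (f : H →* L) (g : G →* H) (k : ℕ) :
    trivialMap R A (f.comp g) k = trivialMap R A f k ≫ trivialMap R A g k := by
  rw [trivialMap, trivialMap, trivialMap, ← groupCohomology.map_comp]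
  exact groupCohomology.map_congr rfl rfl k

end TrivialCoefficients

/-! ### Shapiro's lemma for the function module -/

section Shapiro

variable {R G : Type u} [CommRing R] [Group G] {m : ℕ} (χ : G →* Multiplicative (ZMod m))
  (A : Type u) [AddCommGroup A] [Module R A]

lemma evalZero_comm (g : χ.ker) :
    (LinearMap.proj 0 : (ZMod m → A) →ₗ[R] A) ∘ₗ shiftRepresentation χ A g.1 =
      LinearMap.proj 0 := by
  refine LinearMap.ext fun f => ?_
  change f (0 + (χ g).toAdd) = f 0
  simp [show χ g = 1 from g.2]

variable (R) in
/-- Restriction to the kernel of `χ` followed by evaluation at zero. -/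
noncomputable def shapiroMap (k : ℕ) :
    groupCohomology (shiftRep R χ A) k ⟶ groupCohomology (Rep.trivial R χ.ker A) k :=
  groupCohomology.map χ.ker.subtype (A := shiftRep R χ A) (B := Rep.trivial R χ.ker A)
    (Rep.ofHom ⟨LinearMap.proj 0, evalZero_comm χ A⟩) k

lemma map_constHom_shapiroMap (k : ℕ) :
    groupCohomology.map (MonoidHom.id G) (A := Rep.trivial R G A) (B := shiftRep R χ A)
        (constHom R χ A) k ≫ shapiroMap R χ A k =
      trivialMap R A χ.ker.subtype k := by
  rw [shapiroMap, trivialMap, ← groupCohomology.map_comp]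
  exact groupCohomology.map_congr rfl rfl k

lemma map_constHom_map_totalHom [NeZero m] (k : ℕ) :
    groupCohomology.map (MonoidHom.id G) (A := Rep.trivial R G A) (B := shiftRep R χ A)
        (constHom R χ A) k ≫
      groupCohomology.map (MonoidHom.id G) (A := shiftRep R χ A) (B := Rep.trivial R G A)
        (totalHom R χ A) k = m • 𝟙 _ := by
  have h : constHom R χ A ≫ totalHom R χ A = m • 𝟙 (Rep.trivial R G A) := by
    refine Rep.hom_ext <| Representation.IntertwiningMap.ext <| LinearMap.ext fun (a : A) => ?_
    refine (totalHom_apply χ A _).trans ?_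
    change ∑ x : ZMod m, a = m • a
    simp [ZMod.card]
  rw [← groupCohomology.map_id_comp, h]
  let F := groupCohomology.cochainsFunctor R G ⋙
    HomologicalComplex.homologyFunctor (ModuleCat R) _ k
  exact (F.map_nsmul (f := 𝟙 (Rep.trivial R G A)) (n := m)).trans
    (congrArg (m • ·) (F.map_id _))

variable (R) in
/-- Pulling back functions along `χ`, with values in the coinduced representation. -/
def pullbackToCoind : (ZMod m → A) →ₗ[R]
    Representation.coindV χ.ker.subtype (Representation.trivial R χ.ker A) :=
  LinearMap.codRestrict _ (LinearMap.funLeft R A fun g => (χ g).toAdd) fun f s g => by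
    simp [LinearMap.funLeft_apply, show χ s = 1 from s.2]

lemma pullbackToCoind_bijective (hχ : Function.Surjective χ) :
    Function.Bijective (pullbackToCoind R χ A) := by
  refine ⟨fun f f' h => funext fun x => ?_, fun F => ?_⟩
  · obtain ⟨g, hg⟩ := hχ (Multiplicative.ofAdd x)
    have := congrFun (congrArg Subtype.val h) g
    change f (χ g).toAdd = f' (χ g).toAdd at this
    simpa [hg] using this
  · choose c hc using hχ
    refine ⟨fun x => F.1 (c (Multiplicative.ofAdd x)), Subtype.ext (funext fun g => ?_)⟩
    change F.1 (c (χ g)) = F.1 g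
    -- Elements with equal image under `χ` differ by a left factor in the kernel, under which `F` is
    -- invariant.
    have := F.2 ⟨c (χ g) * g⁻¹, by simp [MonoidHom.mem_ker, hc]⟩ g
    simpa using this

variable (R) in
/-- Functions on `ZMod m` as the coinduction of the trivial representation of `ker χ`. -/
noncomputable def shiftEquivCoind (hχ : Function.Surjective χ) :
    (shiftRepresentation (R := R) χ A).Equiv
      (Representation.coind χ.ker.subtype (Representation.trivial R χ.ker A)) :=
  .mk (LinearEquiv.ofBijective _ (pullbackToCoind_bijective χ A hχ)) fun g => by
    refine LinearMap.ext fun f => Subtype.ext (funext fun x => ?_)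
    change f ((χ x).toAdd + (χ g).toAdd) = f (χ (x * g)).toAdd
    simp

variable (R) in
/-- Shapiro's lemma for functions on `ZMod m`. -/
noncomputable def shapiroIso (hχ : Function.Surjective χ) (k : ℕ) :
    groupCohomology (shiftRep R χ A) k ≅ groupCohomology (Rep.trivial R χ.ker A) k :=
  (groupCohomology.functor R G k).mapIso (Rep.mkIso (shiftEquivCoind R χ A hχ)) ≪≫
    groupCohomology.coindIso (Rep.trivial R χ.ker A) k

/-- An invariant function is determined by its value at `0`, since `G` acts transitively on `ZMod m`
through `χ`. -/
lemma shapiroMap_zero_injective (hχ : Function.Surjective χ) :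
    Function.Injective (shapiroMap R χ A 0) := by
  rw [injective_iff_map_eq_zero]
  intro x hx
  have h := ConcreteCategory.congr_hom (groupCohomology.map_H0Iso_hom_f χ.ker.subtype
    (A := shiftRep R χ A) (B := Rep.trivial R χ.ker A)
    (Rep.ofHom ⟨LinearMap.proj 0, evalZero_comm χ A⟩)) x
  have h0 : ((groupCohomology.H0Iso (shiftRep R χ A)).hom x).1 (0 : ZMod m) = 0 := by
    refine h.symm.trans ?_
    change (groupCohomology.shortComplexH0 (Rep.trivial R χ.ker A)).f
      ((groupCohomology.H0Iso (Rep.trivial R χ.ker A)).hom (shapiroMap R χ A 0 x)) = 0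
    rw [hx, map_zero]
    exact (ModuleCat.Hom.hom _).map_zero
  refine (groupCohomology.H0Iso (shiftRep R χ A)).toLinearEquiv.injective ?_
  rw [map_zero]
  refine Subtype.ext (funext fun y => ?_)
  obtain ⟨g, hg⟩ := hχ (Multiplicative.ofAdd y)
  have hinv := congrFun (((groupCohomology.H0Iso (shiftRep R χ A)).hom x).2 g) (0 : ZMod m)
  refine Eq.trans (congrArg _ ?_) (hinv.trans h0)
  simp [hg]

-- Restriction to the kernel factors through this map and is split by `p`, whence surjectivity. In
-- the finite case the abstract isomorphism `shapiroIso` makes source and target equinumerous, so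
-- injectivity follows without comparing the two maps. Degree `0`, where the cohomology may be
-- infinite, is treated directly.
variable {A} in
lemma shapiroMap_bijective (hχ : Function.Surjective χ) (p : G →* χ.ker) (hp : ∀ s : χ.ker, p s = s)
    (k : ℕ) (hk : k = 0 ∨ Finite (groupCohomology (Rep.trivial R χ.ker A) k)) :
    Function.Bijective (shapiroMap R χ A k) := by
  have hsurj : Function.Surjective (shapiroMap R χ A k) := fun y => by
    refine ⟨groupCohomology.map (MonoidHom.id G) (A := Rep.trivial R G A) (B := shiftRep R χ A)
      (constHom R χ A) k (trivialMap R A p k y), ?_⟩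
    rw [← ModuleCat.comp_apply, map_constHom_shapiroMap, ← ModuleCat.comp_apply, ← trivialMap_comp,
      show p.comp χ.ker.subtype = MonoidHom.id _ from MonoidHom.ext hp, trivialMap_id]
    rfl
  refine ⟨?_, hsurj⟩
  rcases hk with rfl | hk
  · exact shapiroMap_zero_injective χ A hχ
  · have e := (shapiroIso R χ A hχ k).toLinearEquiv.toEquiv
    exact Function.Injective.of_comp_iff' _ e.symm.bijective |>.1 <|
      Finite.injective_iff_surjective.2 <| hsurj.comp e.symm.surjective

end Shapiro

/-! ### The long exact sequence on elements -/

section ElementwiseExactness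

variable {R G : Type u} [CommRing R] [Group G] {X : ShortComplex (Rep.{u} R G)}

lemma CategoryTheory.ShortComplex.Exact.moduleCat_apply_eq_zero_iff
    {S : ShortComplex (ModuleCat.{u} R)}
    (hS : S.Exact) (x : S.X₂) : S.g x = 0 ↔ ∃ y : S.X₁, S.f y = x := by
  refine ⟨(ShortComplex.moduleCat_exact_iff _).1 hS x, fun ⟨y, hy⟩ => ?_⟩
  rw [← hy]
  exact ConcreteCategory.congr_hom S.zero y

namespace groupCohomology

lemma map_f_apply_eq_zero_iff (hX : X.ShortExact) (k : ℕ) (x : groupCohomology X.X₁ (k + 1)) :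
    map (MonoidHom.id G) X.f (k + 1) x = 0 ↔ ∃ y, δ hX k (k + 1) rfl y = x :=
  (mapShortComplex₁_exact hX rfl).moduleCat_apply_eq_zero_iff x

lemma map_g_apply_eq_zero_iff (hX : X.ShortExact) (k : ℕ) (x : groupCohomology X.X₂ k) :
    map (MonoidHom.id G) X.g k x = 0 ↔ ∃ y, map (MonoidHom.id G) X.f k y = x :=
  (mapShortComplex₂_exact hX k).moduleCat_apply_eq_zero_iff x

lemma δ_apply_eq_zero_iff (hX : X.ShortExact) (k : ℕ) (x : groupCohomology X.X₃ k) :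
    δ hX k (k + 1) rfl x = 0 ↔ ∃ y, map (MonoidHom.id G) X.g k y = x :=
  (mapShortComplex₃_exact hX rfl).moduleCat_apply_eq_zero_iff x

end groupCohomology

end ElementwiseExactness

/-! ### The long exact sequences read through Shapiro's lemma -/

section CyclicExtension

variable {R G : Type u} [CommRing R] [Group G] {m : ℕ} [NeZero m]
  (χ : G →* Multiplicative (ZMod m)) (A : Type u) [AddCommGroup A] [Module R A]

variable (R) in
/-- The map on cohomology induced by the inclusion of the constant functions. -/
noncomputable abbrev constMap (k : ℕ) :
    groupCohomology (Rep.trivial R G A) k ⟶ groupCohomology (shiftRep R χ A) k :=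
  groupCohomology.map (MonoidHom.id G) (A := Rep.trivial R G A) (B := shiftRep R χ A)
    (constHom R χ A) k

variable (R) in
/-- The map on cohomology induced by the sum of values. -/
noncomputable abbrev totalMap (k : ℕ) :
    groupCohomology (shiftRep R χ A) k ⟶ groupCohomology (Rep.trivial R G A) k :=
  groupCohomology.map (MonoidHom.id G) (A := shiftRep R χ A) (B := Rep.trivial R G A)
    (totalHom R χ A) k

variable (R) in
/-- The map on cohomology induced by the inclusion of the functions with vanishing sum. -/
noncomputable abbrev zeroSumMap (k : ℕ) :
    groupCohomology (zeroSumRep R χ A) k ⟶ groupCohomology (shiftRep R χ A) k :=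
  groupCohomology.map (MonoidHom.id G) (A := zeroSumRep R χ A) (B := shiftRep R χ A)
    (zeroSumHom R χ A) k

variable (R) in
/-- The connecting map of the constant functions. -/
noncomputable abbrev constδ (k : ℕ) :
    groupCohomology (zeroSumRep R χ A) k ⟶ groupCohomology (Rep.trivial R G A) (k + 1) :=
  groupCohomology.δ (constDiff_shortExact (R := R) χ A) k (k + 1) rfl

variable (R) in
/-- The connecting map of the functions with vanishing sum. -/
noncomputable abbrev zeroSumδ (k : ℕ) :
    groupCohomology (Rep.trivial R G A) k ⟶ groupCohomology (zeroSumRep R χ A) (k + 1) :=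
  groupCohomology.δ (zeroSumTotal_shortExact (R := R) χ A) k (k + 1) rfl

variable (R) in
/-- Restriction to the kernel of `χ`. -/
noncomputable abbrev kerRes (k : ℕ) :
    groupCohomology (Rep.trivial R G A) k ⟶ groupCohomology (Rep.trivial R χ.ker A) k :=
  trivialMap R A χ.ker.subtype k

variable {A}

omit [NeZero m] in
lemma shapiroMap_constMap (k : ℕ) (x) :
    shapiroMap R χ A k (constMap R χ A k x) = kerRes R χ A k x := by
  rw [← ModuleCat.comp_apply, map_constHom_shapiroMap]

lemma totalMap_constMap (k : ℕ) (x) : totalMap R χ A k (constMap R χ A k x) = m • x := by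
  rw [← ModuleCat.comp_apply, map_constHom_map_totalHom]
  rfl

variable {χ}

omit [NeZero m] in
lemma kerRes_trivialMap {p : G →* χ.ker} (hp : ∀ s : χ.ker, p s = s) (k : ℕ) (x) :
    kerRes R χ A k (trivialMap R A p k x) = x := by
  rw [← ModuleCat.comp_apply, ← trivialMap_comp,
    show p.comp χ.ker.subtype = MonoidHom.id _ from MonoidHom.ext hp, trivialMap_id]
  rfl

omit [NeZero m] in
lemma constMap_eq_zero_iff {k : ℕ} (hs : Function.Injective (shapiroMap R χ A k)) (x) :
    constMap R χ A k x = 0 ↔ kerRes R χ A k x = 0 := by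
  rw [← shapiroMap_constMap, map_eq_zero_iff _ hs]

omit [NeZero m] in
lemma constMap_surjective {p : G →* χ.ker} (hp : ∀ s : χ.ker, p s = s) {k : ℕ}
    (hs : Function.Injective (shapiroMap R χ A k)) :
    Function.Surjective (constMap R χ A k) := fun y =>
  ⟨trivialMap R A p k (shapiroMap R χ A k y), hs <| by
    rw [shapiroMap_constMap, kerRes_trivialMap hp]⟩

/-- Every class `y` is the image under `constMap` of `p^*` of its Shapiro image, and summing a
constant function multiplies by `m`. -/
lemma totalMap_eq {p : G →* χ.ker} (hp : ∀ s : χ.ker, p s = s) {k : ℕ}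
    (hs : Function.Injective (shapiroMap R χ A k)) (y) :
    totalMap R χ A k y = m • trivialMap R A p k (shapiroMap R χ A k y) := by
  rw [← totalMap_constMap]
  congr 1
  apply hs
  rw [shapiroMap_constMap, kerRes_trivialMap hp]

lemma nsmul_eq_zero_of_kerRes_eq_zero {k : ℕ}
    (hs : Function.Injective (shapiroMap R χ A k)) {x} (hx : kerRes R χ A k x = 0) :
    m • x = 0 := by
  rw [← totalMap_constMap χ, (constMap_eq_zero_iff hs x).2 hx, map_zero]

/-- The kernel of the connecting map comes from `H^k` of the function module, where every class
already comes from constants. -/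
lemma constδ_injective {p : G →* χ.ker} (hp : ∀ s : χ.ker, p s = s) {k : ℕ}
    (hs : Function.Injective (shapiroMap R χ A k)) :
    Function.Injective (constδ R χ A k) := by
  rw [injective_iff_map_eq_zero]
  intro x hx
  obtain ⟨y, rfl⟩ := (groupCohomology.δ_apply_eq_zero_iff (constDiff_shortExact χ A) k x).1 hx
  obtain ⟨z, rfl⟩ := constMap_surjective hp hs y
  exact (groupCohomology.map_g_apply_eq_zero_iff (constDiff_shortExact χ A) k _).2 ⟨z, rfl⟩

lemma kerRes_eq_zero_iff {k : ℕ} (hs : Function.Injective (shapiroMap R χ A (k + 1))) (x) :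
    kerRes R χ A (k + 1) x = 0 ↔ ∃ y, constδ R χ A k y = x := by
  rw [← constMap_eq_zero_iff hs]
  exact groupCohomology.map_f_apply_eq_zero_iff (constDiff_shortExact χ A) k x

lemma zeroSumδ_eq_zero_iff {p : G →* χ.ker} (hp : ∀ s : χ.ker, p s = s) {k : ℕ}
    (hs : Function.Bijective (shapiroMap R χ A k)) (x) :
    zeroSumδ R χ A k x = 0 ↔ ∃ t, m • trivialMap R A p k t = x := by
  refine (groupCohomology.δ_apply_eq_zero_iff (zeroSumTotal_shortExact χ A) k x).trans
    ⟨fun ⟨y, hy⟩ => ⟨shapiroMap R χ A k y, (totalMap_eq hp hs.1 y).symm.trans hy⟩,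
    fun ⟨t, ht⟩ => ?_⟩
  obtain ⟨y, rfl⟩ := hs.2 t
  exact ⟨y, (totalMap_eq hp hs.1 y).trans ht⟩

lemma shapiroMap_zeroSumMap_eq_zero_iff {k : ℕ}
    (hs : Function.Injective (shapiroMap R χ A (k + 1))) (x) :
    shapiroMap R χ A (k + 1) (zeroSumMap R χ A (k + 1) x) = 0 ↔ ∃ y, zeroSumδ R χ A k y = x := by
  rw [map_eq_zero_iff _ hs]
  exact groupCohomology.map_f_apply_eq_zero_iff (zeroSumTotal_shortExact χ A) k x

lemma nsmul_eq_zero_iff_exists_zeroSumMap {p : G →* χ.ker} (hp : ∀ s : χ.ker, p s = s) {k : ℕ}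
    (hs : Function.Bijective (shapiroMap R χ A k)) (t) :
    m • t = 0 ↔ ∃ x, shapiroMap R χ A k (zeroSumMap R χ A k x) = t := by
  obtain ⟨y, rfl⟩ := hs.2 t
  have hinj : Function.Injective (trivialMap R A p k) :=
    Function.LeftInverse.injective (kerRes_trivialMap hp k)
  rw [← map_eq_zero_iff _ hinj, map_nsmul, ← totalMap_eq hp hs.1]
  refine (groupCohomology.map_g_apply_eq_zero_iff (zeroSumTotal_shortExact χ A) k y).trans ?_
  exact exists_congr fun x => hs.1.eq_iff.symm

lemma zeroSumMap_zero_injective : Function.Injective (zeroSumMap R χ A 0) := by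
  have : Mono (zeroSumHom R χ A) := (zeroSumTotal_shortExact χ A).mono_f
  exact (ModuleCat.mono_iff_injective _).1 (groupCohomology.mono_map_0_of_mono _)

lemma kerRes_zero_injective (hs : Function.Injective (shapiroMap R χ A 0)) :
    Function.Injective (kerRes R χ A 0) := by
  have : Mono (constHom R χ A) := (constDiff_shortExact χ A).mono_f
  have h : Function.Injective (constMap R χ A 0) :=
    (ModuleCat.mono_iff_injective _).1 (groupCohomology.mono_map_0_of_mono _)
  rw [injective_iff_map_eq_zero]
  intro x hx
  rw [← constMap_eq_zero_iff hs] at hx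
  exact h (hx.trans (map_zero _).symm)

end CyclicExtension

/-! ### Groups with free quotient and torsion modulo `m` -/

section FreeZMod

/-- `T ⧸ m T` is isomorphic to `α → ZMod m`. -/
def HasFreeQuotient (T : Type*) [AddCommGroup T] (m : ℕ) (α : Type*) : Prop :=
  ∃ q : T →+ (α → ZMod m), Function.Surjective q ∧ ∀ t, q t = 0 ↔ ∃ s, m • s = t

/-- The `m`-torsion of `T` is isomorphic to `α → ZMod m`. -/
def HasFreeTorsion (T : Type*) [AddCommGroup T] (m : ℕ) (α : Type*) : Prop :=
  ∃ i : (α → ZMod m) →+ T, Function.Injective i ∧ ∀ t, m • t = 0 ↔ ∃ y, i y = t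

lemma HasFreeQuotient.congr {T T' α : Type*} [AddCommGroup T] [AddCommGroup T'] {m : ℕ}
    (h : HasFreeQuotient T m α) (e : T' ≃+ T) : HasFreeQuotient T' m α := by
  obtain ⟨q, hq, h⟩ := h
  refine ⟨q.comp e.toAddMonoidHom, hq.comp e.surjective, fun t => (h (e t)).trans ?_⟩
  refine e.surjective.exists.trans (exists_congr fun s => ?_)
  rw [← map_nsmul, e.injective.eq_iff]

lemma HasFreeTorsion.congr {T T' α : Type*} [AddCommGroup T] [AddCommGroup T'] {m : ℕ}
    (h : HasFreeTorsion T m α) (e : T' ≃+ T) : HasFreeTorsion T' m α := by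
  obtain ⟨i, hi, h⟩ := h
  refine ⟨e.symm.toAddMonoidHom.comp i, e.symm.injective.comp hi, fun t => ?_⟩
  rw [← map_eq_zero_iff e e.injective, map_nsmul, h]
  exact exists_congr fun y => (e.symm_apply_eq).symm

lemma ZMod.castHom_eq_zero_iff {m n : ℕ} [NeZero n] (h : m ∣ n) (t : ZMod n) :
    ZMod.castHom h (ZMod m) t = 0 ↔ ∃ s, m • s = t := by
  obtain ⟨k, rfl⟩ := ZMod.natCast_zmod_surjective t
  rw [map_natCast, ZMod.natCast_eq_zero_iff]
  constructor
  · rintro ⟨l, rfl⟩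
    exact ⟨l, by simp⟩
  · rintro ⟨s, hs⟩
    have := congrArg (ZMod.castHom h (ZMod m)) hs
    rw [map_nsmul, map_natCast, nsmul_eq_mul, ZMod.natCast_self, zero_mul] at this
    rwa [eq_comm, ZMod.natCast_eq_zero_iff] at this

lemma ZMod.exists_torsion_hom {m n : ℕ} [NeZero n] (h : m ∣ n) :
    ∃ i : ZMod m →+ ZMod n, Function.Injective i ∧ ∀ t, m • t = 0 ↔ ∃ y, i y = t := by
  obtain ⟨d, rfl⟩ := h
  have hm : m ≠ 0 := fun h => NeZero.ne (m * d) (by simp [h])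
  have hd : d ≠ 0 := fun h => NeZero.ne (m * d) (by simp [h])
  have hmd : (m : ZMod (m * d)) * d = 0 := by rw [← Nat.cast_mul, ZMod.natCast_self]
  have : NeZero m := ⟨hm⟩
  -- The `m`-torsion of `ZMod (m * d)` is generated by `d`.
  let i : ZMod m →+ ZMod (m * d) := ZMod.lift m ⟨zmultiplesHom _ (d : ZMod (m * d)), by
    simpa using hmd⟩
  have hi : ∀ k : ℕ, i k = (k * d : ℕ) := fun k => by
    have := ZMod.lift_coe m ⟨zmultiplesHom _ (d : ZMod (m * d)), by simpa using hmd⟩ k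
    simpa [i] using this
  refine ⟨i, ?_, fun t => ?_⟩
  · rw [injective_iff_map_eq_zero]
    intro x hx
    obtain ⟨k, rfl⟩ := ZMod.natCast_zmod_surjective x
    rw [hi, ZMod.natCast_eq_zero_iff] at hx
    rw [ZMod.natCast_eq_zero_iff]
    exact Nat.dvd_of_mul_dvd_mul_right (Nat.pos_of_ne_zero hd) hx
  · constructor
    · obtain ⟨k, rfl⟩ := ZMod.natCast_zmod_surjective t
      intro h
      rw [nsmul_eq_mul, ← Nat.cast_mul, ZMod.natCast_eq_zero_iff] at h
      obtain ⟨l, rfl⟩ := Nat.dvd_of_mul_dvd_mul_left (Nat.pos_of_ne_zero hm) h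
      exact ⟨l, by rw [hi, mul_comm d]⟩
    · rintro ⟨y, rfl⟩
      rw [← map_nsmul, nsmul_eq_mul, ZMod.natCast_self, zero_mul, map_zero]

variable {ι : Type*} {κ : ι → Type*} {n : ι → ℕ} {m : ℕ}

lemma hasFreeQuotient_pi (hn : ∀ r, n r ≠ 0) (hm : ∀ r, m ∣ n r) :
    HasFreeQuotient (∀ r, κ r → ZMod (n r)) m (Σ r, κ r) := by
  have := fun r => NeZero.mk (hn r)
  refine ⟨AddMonoidHom.mk' (fun p s => ZMod.castHom (hm s.1) (ZMod m) (p s.1 s.2))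
    (fun p p' => funext fun s => map_add (ZMod.castHom (hm s.1) (ZMod m)) _ _),
    fun y => ?_, fun t => ?_⟩
  · choose x hx using fun s : Σ r, κ r => ZMod.castHom_surjective (hm s.1) (y s)
    exact ⟨fun r k => x ⟨r, k⟩, funext fun s => hx s⟩
  · simp only [AddMonoidHom.mk'_apply, funext_iff, Pi.zero_apply, ZMod.castHom_eq_zero_iff,
      Pi.smul_apply]
    refine ⟨fun h => ?_, fun ⟨s, h⟩ j => ⟨s j.1 j.2, h j.1 j.2⟩⟩
    choose x hx using h
    exact ⟨fun r k => x ⟨r, k⟩, fun r k => hx ⟨r, k⟩⟩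

lemma hasFreeTorsion_pi (hn : ∀ r, n r ≠ 0) (hm : ∀ r, m ∣ n r) :
    HasFreeTorsion (∀ r, κ r → ZMod (n r)) m (Σ r, κ r) := by
  have := fun r => NeZero.mk (hn r)
  choose i hi h using fun r => ZMod.exists_torsion_hom (hm r)
  refine ⟨AddMonoidHom.mk' (fun y r k => i r (y ⟨r, k⟩))
    (fun y y' => funext fun r => funext fun k => map_add (i r) _ _), fun y y' hy => ?_,
    fun t => ?_⟩
  · exact funext fun s => hi s.1 (congrFun (congrFun hy s.1) s.2)
  · simp only [AddMonoidHom.mk'_apply, funext_iff, Pi.zero_apply, Pi.smul_apply, h]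
    refine ⟨fun h => ?_, fun ⟨y, hy⟩ r k => ⟨y ⟨r, k⟩, hy r k⟩⟩
    choose x hx using h
    exact ⟨fun s => x s.1 s.2, fun r k => hx r k⟩

/-- An extension of free `ZMod m`-modules which is annihilated by `m` splits. -/
lemma nonempty_addEquiv_of_exact [NeZero m] {X M T α β : Type*} [AddCommGroup X] [AddCommGroup M]
    [AddCommGroup T] [Fintype β] (hM : ∀ x : M, m • x = 0) (f : X →+ M) (g : M →+ T)
    (hfg : ∀ x, g x = 0 ↔ ∃ y, f y = x) (q : X →+ (α → ZMod m)) (hq : Function.Surjective q)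
    (hqf : ∀ x, q x = 0 ↔ f x = 0) (i : (β → ZMod m) →+ T) (hi : Function.Injective i)
    (hgi : ∀ t, (∃ x, g x = t) ↔ ∃ y, i y = t) :
    Nonempty (M ≃+ (α ⊕ β → ZMod m)) := by
  classical
  let _ := AddCommGroup.zmodModule hM
  -- Since `q` and `f` have the same kernel, `f` descends to an injection of the free module `α →
  -- ZMod m`.
  let f' : (α → ZMod m) →+ M :=
    q.liftOfSurjective hq ⟨f, fun x hx => (hqf x).1 hx⟩
  have hf' : ∀ x, f' (q x) = f x := fun x =>
    q.liftOfRightInverse_comp_apply _ _ ⟨f, fun x hx => (hqf x).1 hx⟩ x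
  -- Lifts of the basis of the quotient; as `m` kills `M`, they extend to a `ZMod m`-linear section
  -- `σ`.
  choose b hb using fun j : β => (hgi (i (Pi.single j 1))).2 ⟨_, rfl⟩
  let σ : (β → ZMod m) →+ M := (Fintype.linearCombination (ZMod m) b).toAddMonoidHom
  have hσ : ∀ v, g (σ v) = i v := by
    intro v
    have : g.comp σ = i := by
      refine AddMonoidHom.functions_ext _ _ _ fun j x => ?_
      obtain ⟨k, rfl⟩ := ZMod.natCast_zmod_surjective x
      have : (Pi.single j (k : ZMod m) : β → ZMod m) = k • Pi.single j 1 := by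
        rw [← Pi.single_smul]; simp
      rw [this, map_nsmul, map_nsmul, ← hb]
      simp [σ, Fintype.linearCombination_apply_single]
    exact DFunLike.congr_fun this v
  let Ψ : (α ⊕ β → ZMod m) →+ M := AddMonoidHom.mk'
    (fun w => f' (w ∘ Sum.inl) + σ (w ∘ Sum.inr)) fun w w' => by
      rw [show (w + w') ∘ Sum.inl = w ∘ Sum.inl + w' ∘ Sum.inl from rfl,
        show (w + w') ∘ Sum.inr = w ∘ Sum.inr + w' ∘ Sum.inr from rfl, map_add, map_add]
      abel
  have hgf : ∀ u, g (f' u) = 0 := fun u => by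
    obtain ⟨x, rfl⟩ := hq u
    exact (hfg _).2 ⟨x, (hf' x).symm⟩
  refine ⟨(AddEquiv.ofBijective Ψ ⟨?_, fun x => ?_⟩).symm⟩
  · rw [injective_iff_map_eq_zero]
    intro w (hw : f' (w ∘ Sum.inl) + σ (w ∘ Sum.inr) = 0)
    have h2 : w ∘ Sum.inr = 0 := by
      apply hi
      rw [map_zero, ← hσ, ← map_zero g, ← hw, map_add, hgf, zero_add]
    rw [h2, map_zero, add_zero] at hw
    obtain ⟨x, hx⟩ := hq (w ∘ Sum.inl)
    rw [← hx, hf', ← hqf, hx] at hw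
    exact funext fun j => j.rec (congrFun hw) (congrFun h2)
  · obtain ⟨v, hv⟩ := (hgi (g x)).1 ⟨x, rfl⟩
    obtain ⟨y, hy⟩ := (hfg (x - σ v)).1 (by rw [map_sub, hσ, hv, sub_self])
    refine ⟨Sum.elim (q y) v, ?_⟩
    change f' (Sum.elim (q y) v ∘ Sum.inl) + σ (Sum.elim (q y) v ∘ Sum.inr) = x
    rw [Sum.elim_comp_inl, Sum.elim_comp_inr, hf', hy, sub_add_cancel]

variable (K : Type*) [Field K] [IsAlgClosed K] [CharZero K]

omit [CharZero K] in
lemma hasFreeQuotient_units (hm : m ≠ 0) : HasFreeQuotient (Additive Kˣ) m (Fin 0) := by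
  refine ⟨0, fun y => ⟨0, Subsingleton.elim _ _⟩, fun t => iff_of_true (Subsingleton.elim _ _) ?_⟩
  obtain ⟨z, hz⟩ := IsAlgClosed.exists_pow_nat_eq (t.toMul : K) (Nat.pos_of_ne_zero hm)
  have hz0 : z ≠ 0 := by
    rintro rfl
    rw [zero_pow hm] at hz
    exact t.toMul.ne_zero hz.symm
  exact ⟨Additive.ofMul (Units.mk0 z hz0), Additive.toMul.injective (Units.ext (by simpa using hz))⟩

lemma hasFreeTorsion_units (hm : m ≠ 0) : HasFreeTorsion (Additive Kˣ) m (Fin 1) := by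
  have : NeZero m := ⟨hm⟩
  have : NeZero (m : K) := ⟨Nat.cast_ne_zero.2 hm⟩
  obtain ⟨ζ', hζ'⟩ := HasEnoughRootsOfUnity.exists_primitiveRoot K m
  obtain ⟨ζ, rfl⟩ := hζ'.isUnit hm
  have hζ : IsPrimitiveRoot ζ m := IsPrimitiveRoot.coe_units_iff.1 hζ'
  let e := hζ.zmodEquivZPowers
  refine ⟨((Subgroup.subtype _).toAdditive.comp e.toAddMonoidHom).comp
    (Pi.evalAddMonoidHom _ 0), ?_, fun t => ?_⟩
  · intro y y' h
    refine funext fun j => ?_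
    rw [Subsingleton.elim j 0]
    exact e.injective (Subtype.val_injective h)
  · have h1 : m • t = 0 ↔ t.toMul ∈ Subgroup.zpowers ζ := by
      rw [hζ.zpowers_eq, mem_rootsOfUnity]
      rfl
    rw [h1]
    constructor
    · intro h
      refine ⟨fun _ => e.symm (Additive.ofMul ⟨_, h⟩), ?_⟩
      change ((e (e.symm (Additive.ofMul ⟨t.toMul, h⟩))).toMul : Kˣ) = t.toMul
      simp
    · rintro ⟨y, rfl⟩
      exact (e (y 0)).toMul.2

end FreeZMod

/-! ### The recursion for the alternating binomial sums -/

section Rank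

/-- The alternating sums of binomial coefficients, as natural numbers. -/
def alternatingRank (s : ℕ) : ℕ → ℕ
  | 0 => 0
  | k + 1 => (s + k).choose k - alternatingRank s k

/-- The natural subtraction never truncates: `alternatingRank s (k + 1) ≤ (s + k).choose k ≤ (s + k
+ 1).choose (k + 1)`. This is where non-negativity comes from. -/
lemma alternatingRank_succ_add (s k : ℕ) :
    alternatingRank s (k + 1) + alternatingRank s k = (s + k).choose k := by
  refine Nat.sub_add_cancel ?_
  cases k with
  | zero => simp [alternatingRank]
  | succ k =>
    refine (Nat.sub_le _ _).trans ?_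
    rw [← add_assoc, Nat.choose_succ_succ]
    exact Nat.le_add_right _ _

lemma alternatingRank_eq_sum (s k : ℕ) : (alternatingRank s k : ℤ) =
    ∑ j ∈ Finset.Icc 1 k, (-1 : ℤ) ^ (k + j) * (Nat.choose (s + j - 1) (j - 1) : ℤ) := by
  induction k with
  | zero => simp [alternatingRank]
  | succ k ih =>
    have h := alternatingRank_succ_add s k
    zify at h
    have h1 : (-1 : ℤ) ^ (k + 1 + (k + 1)) = 1 := Even.neg_one_pow ⟨k + 1, rfl⟩
    have h2 : ∀ j, (-1 : ℤ) ^ (k + 1 + j) = -(-1) ^ (k + j) := fun j => by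
      rw [add_right_comm, pow_succ, mul_neg_one]
    rw [Finset.sum_Icc_succ_top (by lia), h1, eq_sub_of_add_eq h, ih]
    simp only [h2, neg_mul, Finset.sum_neg_distrib, ← add_assoc, Nat.add_sub_cancel]
    ring

lemma sum_range_choose_add (s k : ℕ) :
    ∑ t ∈ Finset.range s, (t + k).choose k = (s + k).choose (k + 1) := by
  induction s with
  | zero => simp
  | succ s ih => rw [Finset.sum_range_succ, ih, add_right_comm, Nat.choose_succ_succ, add_comm]

/-- Pascal's rule splits off `(s + k).choose k`; the other term is a hockey-stick sum of `(t +
k).choose k`, each a sum of two consecutive ranks. -/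
lemma alternatingRank_add_two (s k : ℕ) : alternatingRank s (k + 2) = alternatingRank s k +
    ∑ t ∈ Finset.range s, alternatingRank t k +
      ∑ t ∈ Finset.range s, alternatingRank t (k + 1) := by
  have h1 := alternatingRank_succ_add s k
  have h2 := alternatingRank_succ_add s (k + 1)
  have h3 := sum_range_choose_add s k
  simp only [← alternatingRank_succ_add, Finset.sum_add_distrib] at h3
  rw [← add_assoc, Nat.choose_succ_succ] at h2
  lia

end Rank

/-! ### Reindexing the bases -/

section

variable {T T' α β : Type*} [AddCommGroup T] {m : ℕ}

lemma HasFreeQuotient.reindex (h : HasFreeQuotient T m α) (e : α ≃ β) : HasFreeQuotient T m β := by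
  obtain ⟨q, hq, h⟩ := h
  let E : (α → ZMod m) ≃+ (β → ZMod m) := (LinearEquiv.funCongrLeft (ZMod m) _ e.symm).toAddEquiv
  exact ⟨E.toAddMonoidHom.comp q, E.surjective.comp hq,
    fun t => (map_eq_zero_iff E E.injective).trans (h t)⟩

lemma HasFreeTorsion.reindex (h : HasFreeTorsion T m α) (e : α ≃ β) : HasFreeTorsion T m β := by
  obtain ⟨i, hi, h⟩ := h
  let E : (α → ZMod m) ≃+ (β → ZMod m) := (LinearEquiv.funCongrLeft (ZMod m) _ e.symm).toAddEquiv
  exact ⟨i.comp E.symm.toAddMonoidHom, hi.comp E.symm.injective,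
    fun t => (h t).trans E.symm.surjective.exists⟩

end

/-! ### The kernel of restriction, by recursion on the degree -/

section CyclicExtension

variable {R G : Type u} [CommRing R] [Group G] {m : ℕ} [NeZero m]
  {χ : G →* Multiplicative (ZMod m)} {A : Type u} [AddCommGroup A] [Module R A]
  {p : G →* χ.ker} (hp : ∀ s : χ.ker, p s = s)

variable (R χ A) in
/-- The kernel of the restriction to `ker χ`. -/
noncomputable abbrev resKernel (k : ℕ) :
    Submodule R (groupCohomology (Rep.trivial R G A) k) :=
  LinearMap.ker (kerRes R χ A k).hom

include hp

lemma nonempty_addEquiv_resKernel {k : ℕ} (hs : Function.Injective (shapiroMap R χ A k))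
    (hs' : Function.Injective (shapiroMap R χ A (k + 1))) :
    Nonempty (resKernel R χ A (k + 1) ≃+ groupCohomology (zeroSumRep R χ A) k) := by
  refine ⟨(AddEquiv.ofBijective (AddMonoidHom.mk' (fun x => (⟨constδ R χ A k x,
    (kerRes_eq_zero_iff hs' _).2 ⟨x, rfl⟩⟩ : resKernel R χ A (k + 1)))
    fun x y => Subtype.ext (map_add _ x y)) ⟨fun x y h => ?_, fun x => ?_⟩).symm⟩
  · exact constδ_injective hp hs (congrArg Subtype.val h)
  · obtain ⟨y, hy⟩ := (kerRes_eq_zero_iff hs' x.1).1 x.2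
    exact ⟨y, Subtype.ext hy⟩

/-- In degree `0` no connecting map enters, so only the torsion end of the extension remains. -/
lemma nonempty_zeroSum_zero {b : ℕ} (hs : Function.Bijective (shapiroMap R χ A 0))
    (ht : HasFreeTorsion (groupCohomology (Rep.trivial R χ.ker A) 0) m (Fin b)) :
    Nonempty (groupCohomology (zeroSumRep R χ A) 0 ≃+ (Fin b → ZMod m)) := by
  obtain ⟨i, hi, h⟩ := ht
  let g : groupCohomology (zeroSumRep R χ A) 0 →+ groupCohomology (Rep.trivial R χ.ker A) 0 :=
    (zeroSumMap R χ A 0 ≫ shapiroMap R χ A 0).hom.toAddMonoidHom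
  have hg : Function.Injective g := hs.1.comp zeroSumMap_zero_injective
  have hgi : ∀ t, (∃ x, g x = t) ↔ ∃ y, i y = t := fun t =>
    (nsmul_eq_zero_iff_exists_zeroSumMap hp hs t).symm.trans (h t)
  have hr : g.range = i.range := AddSubgroup.ext hgi
  exact ⟨(AddMonoidHom.ofInjective hg).trans <| (AddEquiv.addSubgroupCongr hr).trans
    (AddMonoidHom.ofInjective hi).symm⟩

lemma nonempty_zeroSum_succ {k a b c : ℕ} (hs : Function.Bijective (shapiroMap R χ A k))
    (hs' : Function.Bijective (shapiroMap R χ A (k + 1)))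
    (hs'' : Function.Injective (shapiroMap R χ A (k + 2)))
    (hq : HasFreeQuotient (groupCohomology (Rep.trivial R χ.ker A) k) m (Fin a))
    (ht : HasFreeTorsion (groupCohomology (Rep.trivial R χ.ker A) (k + 1)) m (Fin b))
    (hc : Nonempty (resKernel R χ A k ≃+ (Fin c → ZMod m))) :
    Nonempty (groupCohomology (zeroSumRep R χ A) (k + 1) ≃+ (Fin (c + a + b) → ZMod m)) := by
  obtain ⟨q, hq, hqt⟩ := hq
  obtain ⟨i, hi, h⟩ := ht
  obtain ⟨e⟩ := hc
  have hker (x) : kerRes R χ A k (x - trivialMap R A p k (kerRes R χ A k x)) = 0 := by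
    rw [map_sub, kerRes_trivialMap hp, sub_self]
  -- Decompose a class along the kernel of restriction and the image of `p^*`, and reduce the second
  -- component modulo `m`. The kernel of `Q` is then the image of `m p^*`, which is the kernel of
  -- `zeroSumδ`.
  let Q : groupCohomology (Rep.trivial R G A) k →+ (Fin c ⊕ Fin a → ZMod m) :=
    AddMonoidHom.mk' (fun x => Sum.elim (e ⟨x - trivialMap R A p k (kerRes R χ A k x), hker x⟩)
      (q (kerRes R χ A k x))) fun x y => by
        rw [← Sum.elim_add_add, ← map_add, ← map_add, ← map_add]
        congr 2
        refine Subtype.ext ?_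
        simp only [map_add, Submodule.coe_add]
        abel
  -- This group embeds into the kernel of restriction one degree higher, which `m` kills because
  -- `totalMap ∘ constMap` is multiplication by `m`.
  have hM : ∀ x : groupCohomology (zeroSumRep R χ A) (k + 1), m • x = 0 := fun x => by
    apply constδ_injective hp hs'.1
    rw [map_nsmul, map_zero]
    exact nsmul_eq_zero_of_kerRes_eq_zero hs'' ((kerRes_eq_zero_iff hs'' _).2 ⟨x, rfl⟩)
  have hQ : Function.Surjective Q := by
    intro y
    obtain ⟨t, ht⟩ := hq (y ∘ Sum.inr)
    obtain ⟨z, hz⟩ := e.surjective (y ∘ Sum.inl)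
    have hr : kerRes R χ A k (z.1 + trivialMap R A p k t) = t := by
      rw [map_add, kerRes_trivialMap hp, show kerRes R χ A k z.1 = 0 from z.2, zero_add]
    refine ⟨z.1 + trivialMap R A p k t, ?_⟩
    have hz' : (⟨_, hker (z.1 + trivialMap R A p k t)⟩ : resKernel R χ A k) = z :=
      Subtype.ext (by dsimp only; rw [hr, add_sub_cancel_right])
    change Sum.elim (e ⟨_, hker _⟩) (q (kerRes R χ A k _)) = y
    rw [hz', hr, hz, ht, Sum.elim_comp_inl_inr]
  have hQ' : ∀ x, Q x = 0 ↔ (zeroSumδ R χ A k).hom.toAddMonoidHom x = 0 := by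
    intro x
    refine Iff.trans ?_ (zeroSumδ_eq_zero_iff hp hs x).symm
    have h1 : Q x = 0 ↔ x - trivialMap R A p k (kerRes R χ A k x) = 0 ∧
        q (kerRes R χ A k x) = 0 := by
      rw [← Sum.elim_zero_zero, show Q x = Sum.elim (e ⟨_, hker _⟩) (q (kerRes R χ A k x)) from rfl,
        Sum.elim_eq_iff, map_eq_zero_iff e e.injective, ← Subtype.coe_inj]
      rfl
    rw [h1, hqt, sub_eq_zero]
    constructor
    · rintro ⟨hx, s, hs⟩
      exact ⟨s, by rw [hx, ← hs, map_nsmul]⟩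
    · rintro ⟨t, rfl⟩
      rw [map_nsmul, kerRes_trivialMap hp, map_nsmul]
      exact ⟨rfl, t, rfl⟩
  obtain ⟨E⟩ := nonempty_addEquiv_of_exact hM (zeroSumδ R χ A k).hom.toAddMonoidHom
    (zeroSumMap R χ A (k + 1) ≫ shapiroMap R χ A (k + 1)).hom.toAddMonoidHom
    (shapiroMap_zeroSumMap_eq_zero_iff hs'.1) Q hQ hQ' i hi fun t =>
      (nsmul_eq_zero_iff_exists_zeroSumMap hp hs' t).symm.trans (h t)
  exact ⟨E.trans (LinearEquiv.funCongrLeft (ZMod m) _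
    (finSumFinEquiv.symm.trans (Equiv.sumCongr finSumFinEquiv.symm (.refl _)))).toAddEquiv⟩

lemma nonempty_resKernel (hχ : Function.Surjective χ) {a b c : ℕ → ℕ}
    (hfin : ∀ k, Finite (groupCohomology (Rep.trivial R χ.ker A) (k + 1)))
    (hq : ∀ k, HasFreeQuotient (groupCohomology (Rep.trivial R χ.ker A) k) m (Fin (a k)))
    (ht : ∀ k, HasFreeTorsion (groupCohomology (Rep.trivial R χ.ker A) k) m (Fin (b k)))
    (h0 : c 0 = 0) (h1 : c 1 = b 0) (h2 : ∀ k, c (k + 2) = c k + a k + b (k + 1)) (k : ℕ) :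
    Nonempty (resKernel R χ A k ≃+ (Fin (c k) → ZMod m)) := by
  have hs : ∀ k, Function.Bijective (shapiroMap R χ A k) := fun k =>
    shapiroMap_bijective χ hχ p hp k <| by
      cases k with
      | zero => exact Or.inl rfl
      | succ k => exact Or.inr (hfin k)
  induction k using Nat.twoStepInduction with
  | zero =>
    have : Subsingleton (resKernel R χ A 0) := by
      rw [Submodule.subsingleton_iff_eq_bot]
      exact LinearMap.ker_eq_bot.2 (kerRes_zero_injective (hs 0).1)
    rw [h0]
    exact ⟨AddEquiv.ofBijective (0 : _ →+ _)
      ⟨fun _ _ _ => Subsingleton.elim _ _, fun _ => ⟨0, Subsingleton.elim _ _⟩⟩⟩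
  | one =>
    obtain ⟨e⟩ := nonempty_addEquiv_resKernel hp (hs 0).1 (hs 1).1
    obtain ⟨e'⟩ := nonempty_zeroSum_zero hp (hs 0) (ht 0)
    rw [h1]
    exact ⟨e.trans e'⟩
  | more k ih _ =>
    obtain ⟨e⟩ := nonempty_addEquiv_resKernel hp (hs (k + 1)).1 (hs (k + 2)).1
    obtain ⟨e'⟩ := nonempty_zeroSum_succ hp (hs k) (hs (k + 1)) (hs (k + 2)).1 (hq k)
      (ht (k + 1)) ih
    rw [h2]
    exact ⟨e.trans e'⟩

omit [NeZero m] in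
lemma nonempty_resKernel_prod (k : ℕ) :
    Nonempty (groupCohomology (Rep.trivial R G A) k ≃+
      resKernel R χ A k × groupCohomology (Rep.trivial R χ.ker A) k) := by
  let f : resKernel R χ A k × groupCohomology (Rep.trivial R χ.ker A) k →+
      groupCohomology (Rep.trivial R G A) k :=
    (resKernel R χ A k).subtype.toAddMonoidHom.coprod (trivialMap R A p k).hom.toAddMonoidHom
  have hf : ∀ x y, f (x, y) = x.1 + trivialMap R A p k y := fun x y => rfl
  have hr : ∀ x y, kerRes R χ A k (f (x, y)) = y := fun x y => by
    rw [hf, map_add, kerRes_trivialMap hp, show kerRes R χ A k x.1 = 0 from x.2, zero_add]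
  refine ⟨(AddEquiv.ofBijective f ⟨?_, fun x => ?_⟩).symm⟩
  · rw [injective_iff_map_eq_zero]
    rintro ⟨x, y⟩ hxy
    have hy : y = 0 := by rw [← hr x y, hxy, map_zero]
    subst hy
    rw [hf, map_zero, add_zero] at hxy
    exact Prod.ext (Subtype.ext hxy) rfl
  · refine ⟨(⟨x - trivialMap R A p k (kerRes R χ A k x), ?_⟩, kerRes R χ A k x), ?_⟩
    · change kerRes R χ A k _ = 0
      rw [map_sub, kerRes_trivialMap hp, sub_self]
    · rw [hf, sub_add_cancel]

end CyclicExtension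

/-! ### Splitting off the first cyclic factor -/

section Splitting

variable {G : Type u} [Group G] {n : ℕ} {m : Fin (n + 1) → ℕ}
  (e : G ≃* Multiplicative (∀ i, ZMod (m i)))

/-- The projection to the first cyclic factor. -/
def headHom : G →* Multiplicative (ZMod (m 0)) :=
  (AddMonoidHom.toMultiplicative (Pi.evalAddMonoidHom (fun i => ZMod (m i)) 0)).comp e.toMonoidHom

lemma headHom_apply (g : G) : (headHom e g).toAdd = (e g).toAdd 0 := rfl

lemma headHom_eq_one_iff (g : G) : headHom e g = 1 ↔ (e g).toAdd 0 = 0 := Iff.rfl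

lemma headHom_surjective : Function.Surjective (headHom e) := fun x =>
  ⟨e.symm (Multiplicative.ofAdd (Pi.single 0 x.toAdd)), by
    apply Multiplicative.toAdd.injective
    rw [headHom_apply]
    simp⟩

/-- The projection which kills the first cyclic factor. -/
def tailEnd : Multiplicative (∀ i, ZMod (m i)) →* Multiplicative (∀ i, ZMod (m i)) :=
  AddMonoidHom.toMultiplicative <| AddMonoidHom.mk' (fun x => Fin.cons 0 (Fin.tail x)) fun x y => by
    refine funext fun i => ?_
    cases i using Fin.cases with
    | zero => exact (add_zero _).symm
    | succ i => rfl

/-- The projection to the kernel of `headHom`. -/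
def tailProj : G →* (headHom e).ker :=
  (e.symm.toMonoidHom.comp (tailEnd.comp e.toMonoidHom)).codRestrict _ fun g => by
    rw [MonoidHom.mem_ker, headHom_eq_one_iff]
    simp [tailEnd]

lemma tailProj_apply (s : (headHom e).ker) : tailProj e s = s := by
  refine Subtype.ext (e.injective ?_)
  have hs : (e s).toAdd 0 = 0 := s.2
  refine (e.apply_symm_apply _).trans (Multiplicative.toAdd.injective (funext fun i => ?_))
  cases i using Fin.cases with
  | zero => exact hs.symm
  | succ i => rfl

/-- The kernel of `headHom` is the product of the remaining cyclic factors. -/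
noncomputable def kerHeadEquiv :
    (headHom e).ker ≃* Multiplicative (∀ i : Fin n, ZMod (m i.succ)) :=
  MulEquiv.ofBijective (((AddMonoidHom.toMultiplicative <| AddMonoidHom.mk'
      (fun (x : ∀ i, ZMod (m i)) (i : Fin n) => x i.succ) fun x y => rfl).comp
      e.toMonoidHom).comp (headHom e).ker.subtype) <| by
    refine ⟨fun s t h => ?_, fun x => ?_⟩
    · refine Subtype.ext (e.injective (Multiplicative.toAdd.injective (funext fun i => ?_)))
      cases i using Fin.cases with
      | zero => exact Eq.trans s.2 t.2.symm
      | succ i => exact congrFun h i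
    · have h : e.symm (Multiplicative.ofAdd (Fin.cons 0 x.toAdd)) ∈ (headHom e).ker := by
        rw [MonoidHom.mem_ker, headHom_eq_one_iff]
        simp
      refine ⟨⟨_, h⟩, Multiplicative.toAdd.injective (funext fun i => ?_)⟩
      change (e (e.symm _)).toAdd i.succ = x.toAdd i
      simp

/-- Splitting off the first factor of a dependent product indexed by `Fin (n + 1)`. -/
def prodAddEquivPi (M : Fin (n + 1) → Type*) [∀ i, AddCommGroup (M i)] :
    (M 0 × ∀ i : Fin n, M i.succ) ≃+ ∀ i, M i where
  toEquiv := Fin.consEquiv M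
  map_add' x y := funext fun i => by
    cases i using Fin.cases with
    | zero => rfl
    | succ i => rfl

end Splitting

/-! ### Induction on the number of factors -/

/-- The cohomology of a finite abelian group in invariant factor form, with coefficients in a
trivial module `A` such that `A ⧸ m A = 0` and `A[m] ≃ ZMod m` for all nonzero `m`. -/
theorem nonempty_groupCohomology_addEquiv {R A : Type u} [CommRing R] [AddCommGroup A] [Module R A]
    (hq : ∀ m ≠ 0, HasFreeQuotient A m (Fin 0)) (ht : ∀ m ≠ 0, HasFreeTorsion A m (Fin 1)) {n : ℕ}
    (m : Fin n → ℕ) (hm : ∀ i, m i ≠ 0) (hdvd : ∀ i j, i ≤ j → m i ∣ m j) {G : Type u} [Group G]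
    (e : G ≃* Multiplicative (∀ i, ZMod (m i))) (k : ℕ) :
    Nonempty (groupCohomology (Rep.trivial R G A) (k + 1) ≃+
      ∀ r : Fin n, Fin (alternatingRank (n - (r + 1)) (k + 1)) → ZMod (m r)) := by
  induction n generalizing G k with
  | zero =>
    have : Subsingleton G := e.toEquiv.subsingleton
    have := ModuleCat.subsingleton_of_isZero
      (isZero_groupCohomology_succ_of_subsingleton (Rep.trivial R G A) k)
    exact ⟨AddEquiv.ofBijective (0 : _ →+ _)
      ⟨fun _ _ _ => Subsingleton.elim _ _, fun _ => ⟨0, Subsingleton.elim _ _⟩⟩⟩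
  | succ n ih =>
    have : NeZero (m 0) := ⟨hm 0⟩
    have hm' : ∀ i, NeZero (m i) := fun i => ⟨hm i⟩
    have E := fun k => (ih (fun i => m i.succ) (fun i => hm _)
      (fun i j hij => hdvd _ _ (Fin.succ_le_succ_iff.2 hij)) (kerHeadEquiv e) k).some
    have hsum (k : ℕ) : Fintype.card (Σ r : Fin n, Fin (alternatingRank (n - (r + 1)) k)) =
        ∑ t ∈ Finset.range n, alternatingRank t k := by
      rw [Fintype.card_sigma]
      simp only [Fintype.card_fin]
      rw [Fin.sum_univ_eq_sum_range (fun t => alternatingRank (n - (t + 1)) k) n,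
        ← Finset.sum_range_reflect]
      exact Finset.sum_congr rfl fun t ht => by
        rw [Finset.mem_range] at ht
        congr 1
        lia
    let r (k : ℕ) := ∑ t ∈ Finset.range n, alternatingRank t k
    have eqv (k : ℕ) : (Σ r : Fin n, Fin (alternatingRank (n - (r + 1)) k)) ≃ Fin (r k) :=
      Fintype.equivFinOfCardEq (hsum k)
    have e0 : groupCohomology (Rep.trivial R (headHom e).ker A) 0 ≃+ A :=
      (groupCohomology.H0IsoOfIsTrivial (Rep.trivial R (headHom e).ker A)).toLinearEquiv.toAddEquiv
    have hr0 : r 0 = 0 := by simp [r, alternatingRank]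
    -- Degree `0` is exceptional: the cohomology is `A` itself, with quotient rank `0` and torsion
    -- rank `1`. In positive degrees both ranks equal `r k`, by the induction hypothesis and the
    -- divisibility by `m 0`.
    obtain ⟨E₁⟩ := nonempty_resKernel (R := R) (A := A) (tailProj_apply e) (headHom_surjective e)
      (a := r) (b := fun k => if k = 0 then 1 else r k) (c := alternatingRank n)
      (fun k => (E k).toEquiv.finite_iff.2 inferInstance)
      (fun k => by
        cases k with
        | zero =>
          rw [hr0]
          exact (hq _ (hm 0)).congr e0
        | succ k =>
          exact ((hasFreeQuotient_pi (fun i => hm _) fun i => hdvd _ _ (Fin.zero_le _)).congr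
            (E k)).reindex (eqv _))
      (fun k => by
        cases k with
        | zero => exact (ht _ (hm 0)).congr e0
        | succ k =>
          exact ((hasFreeTorsion_pi (fun i => hm _) fun i => hdvd _ _ (Fin.zero_le _)).congr
            (E k)).reindex (eqv _))
      rfl (by simp [alternatingRank]) (fun k => by simpa [r] using alternatingRank_add_two n k)
      (k + 1)
    obtain ⟨E₂⟩ := nonempty_resKernel_prod (R := R) (A := A) (tailProj_apply e) (k + 1)
    have E₃ := (E₂.trans (E₁.prodCongr (E k))).trans (prodAddEquivPi fun i : Fin (n + 1) =>
      Fin (Fin.cons (α := fun _ => ℕ) (alternatingRank n (k + 1))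
        (fun r : Fin n => alternatingRank (n - (r + 1)) (k + 1)) i) → ZMod (m i))
    have hN : (Fin.cons (α := fun _ => ℕ) (alternatingRank n (k + 1))
        (fun r : Fin n => alternatingRank (n - (r + 1)) (k + 1)) : Fin (n + 1) → ℕ) =
        fun r : Fin (n + 1) => alternatingRank (n + 1 - (r + 1)) (k + 1) := by
      funext i
      cases i using Fin.cases with
      | zero => simp
      | succ i => simp [Nat.add_sub_add_right]
    rw [hN] at E₃
    exact ⟨E₃⟩

lemma dvd_of_dvd_succ {n : ℕ} {m : Fin n → ℕ}
    (hdvd : ∀ (i : ℕ) (hi : i + 1 < n), m ⟨i, Nat.lt_of_succ_lt hi⟩ ∣ m ⟨i + 1, hi⟩)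
    (i j : Fin n) (hij : i ≤ j) : m i ∣ m j := by
  obtain ⟨i, hi⟩ := i
  obtain ⟨j, hj⟩ := j
  induction j, (show i ≤ j from hij) using Nat.le_induction with
  | base => exact dvd_rfl
  | succ j hle ih => exact (ih (by lia) hle).trans (hdvd j hj)

/-- Indices `r : Fin n` start at `0`, so `r + 1` here is the `r` of the formula. -/
theorem mainTheorem6 {K : Type u} [Field K] [IsAlgClosed K] [CharZero K]
    (n : ℕ) (m : Fin n → ℕ) (hpos : ∀ i, 0 < m i)
    (hdvd : ∀ (i : ℕ) (hi : i + 1 < n), m ⟨i, Nat.lt_of_succ_lt hi⟩ ∣ m ⟨i + 1, hi⟩)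
    (k : ℕ) (hk : 1 ≤ k) :
    ∃ N : Fin n → ℕ,
      (∀ r : Fin n, (N r : ℤ) =
        ∑ j ∈ Finset.Icc 1 k,
          (-1 : ℤ) ^ (k + j) * (Nat.choose (n - ((r : ℕ) + 1) + j - 1) (j - 1) : ℤ)) ∧
      Nonempty (unitsCohomology (Multiplicative (∀ i : Fin n, ZMod (m i))) K k ≃+
        (∀ r : Fin n, Fin (N r) → ZMod (m r))) := by
  obtain ⟨k, rfl⟩ := Nat.exists_eq_add_of_le' hk
  exact ⟨fun r => alternatingRank (n - (r + 1)) (k + 1), fun r => alternatingRank_eq_sum _ _,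
    nonempty_groupCohomology_addEquiv (fun m hm => hasFreeQuotient_units K hm)
      (fun m hm => hasFreeTorsion_units K hm) m (fun i => (hpos i).ne') (dvd_of_dvd_succ hdvd)
      MulEquiv.ulift k⟩
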